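/- Let $\mathcal H\neq\{0\}$ be a separable complex Hilbert space and let $T$ be a bounded linear operator on $\mathcal H$. A *proper Følner sequence* for $T$ is an increasing sequence $(P_n)_{n\in\mathbb N}$ of non-zero finite rank orthogonal projections on $\mathcal H$ that converges strongly to the identity and satisfies $$\lim_{n\to\infty}\frac{\|TP_n-P_nT\|_2}{\|P_n\|_2}=0,$$ where $\|\cdot\|_2$ denotes the Hilbert–Schmidt norm. Write $[T^*,T]=T^*T-TT^*$. 1. If $T$ is essentially normal, that is, if $[T^*,T]$ is compact, then $T$ has a proper Følner sequence. 2. If $T$ is hyponormal, that is, if $[T^*,T]\ge 0$, then $T$ has a proper Følner sequence. In particular, $T$ has a proper Følner sequence if it is subnormal (there are a Hilbert space $\mathcal K\supseteq\mathcal H$ and a normal bounded operator $N$ on $\mathcal K$ with $N|_{\mathcal H}=T$), if it is quasinormal ($T$ commutes with $T^*T$), or if it is an isometry. -/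

import Mathlib

open Filter Topology
open scoped ENNReal

universe u v

namespace FolnerOp

/-- The square of the Hilbert–Schmidt norm of `T`, computed in the Hilbert basis `b`:
`∑ i, ‖T (b i)‖²`, with value in `[0, ∞]`. -/
noncomputable def hsNormSqBasis {H : Type*} [NormedAddCommGroup H] [InnerProductSpace ℂ H]
    {ι : Type*} (b : HilbertBasis ι ℂ H) (T : H →L[ℂ] H) : ℝ≥0∞ :=
  ∑' i, ‖T (b i)‖ₑ ^ 2

/-- Parseval's identity with values in `[0, ∞]`. -/
theorem tsum_enorm_inner_sq {H : Type*} [NormedAddCommGroup H] [InnerProductSpace ℂ H]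
    {ι : Type*} (b : HilbertBasis ι ℂ H) (x : H) :
    ∑' i, ‖inner ℂ (b i) x‖ₑ ^ 2 = ‖x‖ₑ ^ 2 := by
  have h : HasSum (fun i => ‖inner ℂ (b i) x‖ ^ 2) (‖x‖ ^ 2) := by
    have h1 := b.hasSum_inner_mul_inner x x
    have h2 := (Complex.reCLM.hasSum h1)
    convert h2 using 1
    · funext i
      have h3 : inner ℂ x (b i) = (starRingEnd ℂ) (inner ℂ (b i) x) := (inner_conj_symm _ _).symm
      rw [h3, Complex.conj_mul', ← Complex.ofReal_pow]
      rfl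
    · rw [inner_self_eq_norm_sq_to_K]
      simp [← Complex.ofReal_pow]
  have h3 : ∀ y : ℝ, 0 ≤ y → ENNReal.ofReal (y ^ 2) = ENNReal.ofReal y ^ 2 :=
    fun y hy => ENNReal.ofReal_pow hy 2
  have h4 := ENNReal.ofReal_tsum_of_nonneg (fun i => sq_nonneg ‖inner ℂ (b i) x‖) h.summable
  rw [h.tsum_eq, h3 _ (norm_nonneg _)] at h4
  simpa [h3 _ (norm_nonneg _), ofReal_norm] using h4.symm

/-- The value of `hsNormSqBasis` for `T` in one basis equals that for `T†` in any other. -/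
theorem hsNormSqBasis_adjoint {H : Type*} [NormedAddCommGroup H] [InnerProductSpace ℂ H]
    [CompleteSpace H] {ι κ : Type*} (b : HilbertBasis ι ℂ H) (c : HilbertBasis κ ℂ H)
    (T : H →L[ℂ] H) :
    hsNormSqBasis b T = hsNormSqBasis c (ContinuousLinearMap.adjoint T) := by
  unfold hsNormSqBasis
  simp_rw [← tsum_enorm_inner_sq c (T (b _)),
    ← tsum_enorm_inner_sq b (ContinuousLinearMap.adjoint T (c _))]
  rw [ENNReal.tsum_comm]
  refine tsum_congr fun j => tsum_congr fun i => ?_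
  rw [ContinuousLinearMap.adjoint_inner_right, ← inner_conj_symm]
  simp only [enorm_eq_nnnorm, RCLike.nnnorm_conj]

/-- The Hilbert–Schmidt norm does not depend on the basis. -/
theorem hsNormSqBasis_eq {H : Type*} [NormedAddCommGroup H] [InnerProductSpace ℂ H]
    [CompleteSpace H] {ι κ : Type*} (b : HilbertBasis ι ℂ H) (c : HilbertBasis κ ℂ H)
    (T : H →L[ℂ] H) : hsNormSqBasis b T = hsNormSqBasis c T :=
  (hsNormSqBasis_adjoint b c T).trans (hsNormSqBasis_adjoint c c T).symm

/-- The Hilbert–Schmidt norm `‖T‖₂ = (∑ i, ‖T eᵢ‖²)^(1/2) ∈ [0, ∞]`, where `(eᵢ)` is some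
Hilbert basis of `H`; by `hsNorm_eq` any Hilbert basis gives the same value. -/
noncomputable def hsNorm {H : Type*} [NormedAddCommGroup H] [InnerProductSpace ℂ H]
    [CompleteSpace H] (T : H →L[ℂ] H) : ℝ≥0∞ :=
  hsNormSqBasis (exists_hilbertBasis ℂ H).choose_spec.choose T ^ (1 / 2 : ℝ)

theorem hsNorm_eq {H : Type*} [NormedAddCommGroup H] [InnerProductSpace ℂ H]
    [CompleteSpace H] {ι : Type*} (b : HilbertBasis ι ℂ H) (T : H →L[ℂ] H) :
    hsNorm T = (∑' i, ‖T (b i)‖ₑ ^ 2) ^ (1 / 2 : ℝ) := by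
  rw [hsNorm, hsNormSqBasis_eq _ b, hsNormSqBasis]

/-- `P` is a Følner sequence for the set `𝒯` of bounded operators: a sequence of non-zero
finite rank orthogonal projections such that `‖T Pₙ - Pₙ T‖₂ / ‖Pₙ‖₂ → 0` for all `T ∈ 𝒯`. -/
structure IsFolnerSeq {H : Type*} [NormedAddCommGroup H] [InnerProductSpace ℂ H]
    [CompleteSpace H] (𝒯 : Set (H →L[ℂ] H)) (P : ℕ → H →L[ℂ] H) : Prop where
  isStarProjection : ∀ n, IsStarProjection (P n)
  ne_zero : ∀ n, P n ≠ 0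
  finiteRank : ∀ n, FiniteDimensional ℂ (LinearMap.range (P n).toLinearMap)
  tendsto_zero : ∀ T ∈ 𝒯,
    Tendsto (fun n => hsNorm (T * P n - P n * T) / hsNorm (P n)) atTop (𝓝 0)

/-- A Følner sequence is proper if it is increasing and converges strongly to the identity.
(`≤` on operators is the Loewner order, which on orthogonal projections is inclusion of
ranges.) -/
structure IsProperFolnerSeq {H : Type*} [NormedAddCommGroup H] [InnerProductSpace ℂ H]
    [CompleteSpace H] (𝒯 : Set (H →L[ℂ] H)) (P : ℕ → H →L[ℂ] H) : Prop
    extends IsFolnerSeq 𝒯 P where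
  monotone : Monotone P
  tendsto_id : ∀ x : H, Tendsto (fun n => P n x) atTop (𝓝 x)

/-- The operator `T` has a proper Følner sequence. -/
def HasProperFolnerSeq {H : Type*} [NormedAddCommGroup H] [InnerProductSpace ℂ H]
    [CompleteSpace H] (T : H →L[ℂ] H) : Prop :=
  ∃ P : ℕ → H →L[ℂ] H, IsProperFolnerSeq {T} P

/-- The self-commutator `[T*, T] = T* T - T T*`. -/
noncomputable def selfCommutator {H : Type*} [NormedAddCommGroup H] [InnerProductSpace ℂ H]
    [CompleteSpace H] (T : H →L[ℂ] H) : H →L[ℂ] H :=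
  star T * T - T * star T

/-- `T` is essentially normal if `[T*, T]` is compact. -/
def IsEssentiallyNormal {H : Type*} [NormedAddCommGroup H] [InnerProductSpace ℂ H]
    [CompleteSpace H] (T : H →L[ℂ] H) : Prop :=
  IsCompactOperator (selfCommutator T)

/-- `T` is hyponormal if `[T*, T]` is nonnegative. -/
def IsHyponormal {H : Type*} [NormedAddCommGroup H] [InnerProductSpace ℂ H]
    [CompleteSpace H] (T : H →L[ℂ] H) : Prop :=
  (selfCommutator T).IsPositive

/-- `T` is quasinormal if `T` and `T* T` commute. -/
def IsQuasinormal {H : Type*} [NormedAddCommGroup H] [InnerProductSpace ℂ H]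
    [CompleteSpace H] (T : H →L[ℂ] H) : Prop :=
  Commute T (star T * T)

/-- `T` is subnormal if it is the restriction of a normal operator `N`, on a Hilbert space `K`
that contains `H` (through a linear isometry `V`), to `H`. -/
def IsSubnormal {H : Type u} [NormedAddCommGroup H] [InnerProductSpace ℂ H]
    (T : H →L[ℂ] H) : Prop :=
  ∃ (K : Type v) (_ : NormedAddCommGroup K) (_ : InnerProductSpace ℂ K) (_ : CompleteSpace K)
    (V : H →ₗᵢ[ℂ] K) (N : K →L[ℂ] K), IsStarNormal N ∧ ∀ x, N (V x) = V (T x)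

end FolnerOp

/-!
In finite dimension the constant sequence `1` works, so let `H` be infinite dimensional. The point
is that `T` has approximately reducing eigenvectors: there is `z : ℂ` such that `A = T - z`
satisfies, for every finite dimensional `F` and `ε > 0`, both `‖A x‖ ≤ ε` and `‖A* x‖ ≤ ε` for some
unit vector `x ⟂ F` (`exists_hasApproxReducingVectors`).

To find `z`, take a boundary point of the spectrum of `T` in the Calkin algebra. At such a point `A`
has no left inverse modulo the compact operators (`not_leftInverse_of_mem_frontier_spectrum`). Hence
`A* A` is not coercive on any subspace of finite codimension (`exists_leftInverse_mod_compact`). For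
hyponormal `T` this is enough, as `‖A* x‖ ≤ ‖A x‖`; for essentially normal `T` the same holds for
`A* A + A A*`, which is `2 A* A` modulo the compact operators.

The vectors `x` span almost reducing subspaces `V ⟂ F` of arbitrarily large dimension, on which the
commutator of `T` with the projection is small relative to `‖P_V‖₂ = √(dim V)`, while the commutator
with `P_F` has a fixed Hilbert–Schmidt norm. So the projection onto `F ⊔ V` almost commutes with `T`
(`exists_almostCommuting_superspace`), and iterating along a dense sequence gives the proper Følner
sequence. Subnormal and quasinormal operators and isometries are hyponormal.
-/

namespace FolnerOp

/-! ### Quotients of Banach algebras and the boundary of the spectrum -/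

section BanachAlgebraQuotient

variable {R : Type*} [NormedRing R] (I : Ideal R) [I.IsTwoSided]

/-- The quotient of a normed ring by a closed two-sided ideal, with the quotient norm; Mathlib has
this only for commutative rings. An `abbrev` and not an instance, so that it does not compete with
the commutative instance. -/
noncomputable abbrev quotientNormedRing [IsClosed (I : Set R)] : NormedRing (R ⧸ I) :=
  { Ideal.Quotient.ring I, Submodule.Quotient.normedAddCommGroup I with
    norm_mul_le := fun x y => by
      refine le_of_forall_pos_lt_add fun ε hε => ?_
      have hc : Tendsto (fun δ : ℝ => (‖x‖ + δ) * (‖y‖ + δ)) (𝓝[>] 0) (𝓝 (‖x‖ * ‖y‖)) := by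
        have : Continuous fun δ : ℝ => (‖x‖ + δ) * (‖y‖ + δ) := by fun_prop
        simpa using (this.tendsto 0).mono_left nhdsWithin_le_nhds
      obtain ⟨δ, hδ, hδ0⟩ := ((hc.eventually_lt_const (lt_add_of_pos_right _ hε)).and
        self_mem_nhdsWithin).exists
      obtain ⟨a, rfl, ha⟩ := Submodule.Quotient.norm_mk_lt x hδ0
      obtain ⟨b, rfl, hb⟩ := Submodule.Quotient.norm_mk_lt y hδ0
      calc _ ≤ ‖a * b‖ := Submodule.Quotient.norm_mk_le I (a * b)
        _ ≤ ‖a‖ * ‖b‖ := norm_mul_le a b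
        _ ≤ _ := by gcongr
        _ < _ := hδ }

/-- The complex normed algebra structure on the quotient by a closed two-sided ideal. -/
noncomputable abbrev quotientNormedAlgebra [IsClosed (I : Set R)] [NormedAlgebra ℂ R] :
    @NormedAlgebra ℂ (R ⧸ I) _ (quotientNormedRing I).toSeminormedRing :=
  letI := quotientNormedRing I
  { Ideal.Quotient.algebra (I := I) ℂ with
    norm_smul_le := (Submodule.Quotient.normedSpace I ℂ).norm_smul_le }

end BanachAlgebraQuotient

/-- At a boundary point `z` of the spectrum, `a - z` is not even left invertible: a left inverse `s`
of `a - z` makes `s * (a - w)` invertible for `w` near `z`, and such `w` can be taken in the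
resolvent set, so that `s`, and with it `a - z`, would be invertible. -/
theorem not_leftInverse_of_mem_frontier_spectrum {A : Type*} [NormedRing A] [CompleteSpace A]
    [NormedAlgebra ℂ A] {a : A} {z : ℂ} (hz : z ∈ frontier (spectrum ℂ a)) (s : A) :
    s * (a - algebraMap ℂ A z) ≠ 1 := by
  intro hs
  have hzs : z ∈ spectrum ℂ a := (spectrum.isClosed a).frontier_subset hz
  rw [← frontier_compl] at hz
  have hz' : z ∈ closure (spectrum ℂ a)ᶜ := frontier_subset_closure hz
  have hc : Continuous fun w : ℂ => s * (a - algebraMap ℂ A w) := by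
    have := algebraMapCLM ℂ A |>.continuous
    change Continuous (algebraMap ℂ A) at this
    fun_prop
  have hopen : IsOpen {w : ℂ | IsUnit (s * (a - algebraMap ℂ A w))} :=
    Units.isOpen.preimage hc
  obtain ⟨w, hw, hw'⟩ := mem_closure_iff.1 hz' _ hopen (by simp [hs])
  have h1 : IsUnit (a - algebraMap ℂ A w) := by
    have : IsUnit (algebraMap ℂ A w - a) := spectrum.notMem_iff.1 hw'
    simpa using this.neg
  have h2 : IsUnit s := by
    obtain ⟨u, hu⟩ := h1
    have hw : IsUnit (s * (a - algebraMap ℂ A w)) := hw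
    rw [← hu] at hw
    simpa using hw
  have h3 : IsUnit (a - algebraMap ℂ A z) := by
    obtain ⟨u, rfl⟩ := h2
    rw [Units.mul_eq_one_iff_inv_eq] at hs
    exact hs ▸ u⁻¹.isUnit
  exact hzs (by simpa [resolventSet] using h3.neg)

/-! ### Left invertibility modulo compact operators -/

section Calkin

variable {H : Type*} [NormedAddCommGroup H] [InnerProductSpace ℂ H]

variable (H) in
/-- The ideal of compact operators in the ring of bounded operators on `H`. -/
def compactIdeal : Ideal (H →L[ℂ] H) where
  carrier := {T | IsCompactOperator T}
  add_mem' := fun {_ _} ha hb => IsCompactOperator.add ha hb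
  zero_mem' := isCompactOperator_zero
  smul_mem' := fun c _ hx => IsCompactOperator.clm_comp hx c

instance : (compactIdeal H).IsTwoSided :=
  ⟨fun b ha => IsCompactOperator.comp_clm ha b⟩

theorem mem_compactIdeal {T : H →L[ℂ] H} : T ∈ compactIdeal H ↔ IsCompactOperator T := Iff.rfl

/-- Some `T - z` has no left inverse modulo the compact operators: take `z` on the boundary of the
spectrum of `T` in the Calkin algebra. Here infinite dimension is what makes the Calkin algebra
nontrivial, and hence that spectrum nonempty. -/
theorem exists_forall_not_leftInverse_mod_compact [CompleteSpace H]
    (hH : ¬ FiniteDimensional ℂ H) (T : H →L[ℂ] H) :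
    ∃ z : ℂ, ∀ S : H →L[ℂ] H,
      ¬ IsCompactOperator (S * (T - algebraMap ℂ (H →L[ℂ] H) z) - 1 : H →L[ℂ] H) := by
  have : IsClosed (compactIdeal H : Set (H →L[ℂ] H)) :=
    isClosed_setOfPred_isCompactOperator
  let := quotientNormedRing (compactIdeal H)
  let := quotientNormedAlgebra (compactIdeal H)
  have : CompleteSpace ((H →L[ℂ] H) ⧸ compactIdeal H) :=
    Submodule.Quotient.completeSpace _
  have : Nontrivial ((H →L[ℂ] H) ⧸ compactIdeal H) := by
    rw [Ideal.Quotient.nontrivial_iff, Ne, Ideal.eq_top_iff_one]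
    exact fun h => hH (FiniteDimensional.of_isCompactOperator_id (𝕜 := ℂ) h)
  set π := Ideal.Quotient.mk (compactIdeal H)
  have hfr : (frontier (spectrum ℂ (π T))).Nonempty := by
    rw [nonempty_frontier_iff]
    refine ⟨spectrum.nonempty _, fun h => ?_⟩
    have := spectrum.isCompact (𝕜 := ℂ) (π T)
    rw [h] at this
    exact noncompact_univ ℂ this
  obtain ⟨z, hz⟩ := hfr
  refine ⟨z, fun S hS => not_leftInverse_of_mem_frontier_spectrum hz (π S) ?_⟩
  have h := (Ideal.Quotient.eq (I := compactIdeal H)).2 (mem_compactIdeal.2 hS)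
  simpa [π] using h

theorem isCompactOperator_starProjection (F : Submodule ℂ H) [FiniteDimensional ℂ F] :
    IsCompactOperator F.starProjection := by
  have : IsCompactOperator F.orthogonalProjectionOnto :=
    isCompactOperator_of_locallyCompactSpace_dom _
  exact this.clm_comp F.subtypeL

/-- A self-adjoint operator that is coercive on a subspace of finite codimension is left invertible
modulo the compact operators. -/
theorem exists_leftInverse_mod_compact [CompleteSpace H] {M : H →L[ℂ] H} (hM : IsSelfAdjoint M)
    (F : Submodule ℂ H) [FiniteDimensional ℂ F] {c : ℝ} (hc : 0 < c)
    (h : ∀ x ∈ Fᗮ, c * ‖x‖ ^ 2 ≤ (inner ℂ (M x) x).re) :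
    ∃ S : H →L[ℂ] H, IsCompactOperator (S * M - 1 : H →L[ℂ] H) := by
  set P := F.starProjection with hPdef
  set Q := Fᗮ.starProjection with hQdef
  have hPs : IsSelfAdjoint P := isSelfAdjoint_starProjection F
  have hQs : IsSelfAdjoint Q := isSelfAdjoint_starProjection Fᗮ
  have hQ : Q = 1 - P := by
    rw [hQdef, Submodule.starProjection_orthogonal']
  -- `Q * M * Q + P` is coercive on all of `H`, hence invertible, and it differs from `M` by a
  -- finite rank operator.
  have hB : IsSelfAdjoint (Q * M * Q + P) := by
    refine .add ?_ hPs
    have := hM.conjugate Q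
    rwa [hQs.star_eq] at this
  have hpos : algebraMap ℝ (H →L[ℂ] H) (min c 1) ≤ Q * M * Q + P := by
    rw [ContinuousLinearMap.le_def, ContinuousLinearMap.isPositive_def']
    refine ⟨hB.sub (.algebraMap _ (.all _)), fun x => ?_⟩
    have h1 := h (Q x) (Submodule.starProjection_apply_mem _ x)
    have h2 : (inner ℂ (P x) x).re = ‖P x‖ ^ 2 := F.re_inner_starProjection_eq_normSq x
    have h3 : inner ℂ (Q (M (Q x))) x = inner ℂ (M (Q x)) (Q x) :=
      Submodule.inner_starProjection_left_eq_right _ _ _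
    have h4 := Submodule.norm_sq_eq_add_norm_sq_starProjection x F
    have h5 : min c 1 ≤ c := min_le_left _ _
    have h6 : min c 1 ≤ 1 := min_le_right _ _
    have h7 : ((inner ℂ ((algebraMap ℝ (H →L[ℂ] H) (min c 1)) x) x).re) = min c 1 * ‖x‖ ^ 2 := by
      rw [Algebra.algebraMap_eq_smul_one]
      simp only [smul_apply, one_apply_eq_self]
      rw [← Complex.coe_smul, inner_smul_left, inner_self_eq_norm_sq_to_K]
      simp [← Complex.ofReal_pow]
    simp only [ContinuousLinearMap.reApplyInnerSelf_apply, sub_apply,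
      add_apply, mul_apply_eq_comp, inner_sub_left, inner_add_left,
      h3, RCLike.re_to_complex, Complex.sub_re, Complex.add_re, h2, h7]
    rw [h4]
    nlinarith [sq_nonneg ‖P x‖, sq_nonneg ‖Q x‖]
  have hu : IsUnit (Q * M * Q + P) := by
    have : IsStrictlyPositive (algebraMap ℝ (H →L[ℂ] H) (min c 1)) :=
      isStrictlyPositive_algebraMap (lt_min hc one_pos)
    exact (this.of_le hpos).isUnit
  obtain ⟨u, hu⟩ := hu
  refine ⟨(u⁻¹ : (H →L[ℂ] H)ˣ), ?_⟩
  have hk : (u : H →L[ℂ] H) - M ∈ compactIdeal H := by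
    have hP : P ∈ compactIdeal H := isCompactOperator_starProjection F
    have : (u : H →L[ℂ] H) - M = P * M * P + P - M * P - P * M := by
      rw [hu, hQ]; noncomm_ring
    rw [this]
    exact sub_mem (sub_mem (add_mem (Ideal.mul_mem_left _ _ hP) hP) (Ideal.mul_mem_left _ _ hP))
      (Ideal.mul_mem_right _ _ hP)
  have := (compactIdeal H).neg_mem ((compactIdeal H).mul_mem_left (u⁻¹ : (H →L[ℂ] H)ˣ) hk)
  rw [mul_sub, Units.inv_mul, neg_sub] at this
  exact this

end Calkin

/-! ### Approximately reducing eigenvectors -/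

section ApproxReducing

variable {H : Type*} [NormedAddCommGroup H] [InnerProductSpace ℂ H] [CompleteSpace H]

theorem re_inner_selfCommutator_apply (T : H →L[ℂ] H) (x : H) :
    (inner ℂ (selfCommutator T x) x).re = ‖T x‖ ^ 2 - ‖star T x‖ ^ 2 := by
  have h1 : inner ℂ ((star T) (T x)) x = inner ℂ (T x) (T x) :=
    ContinuousLinearMap.adjoint_inner_left T x (T x)
  have h2 : inner ℂ (T (star T x)) x = inner ℂ (star T x) (star T x) :=
    (ContinuousLinearMap.adjoint_inner_right T (star T x) x).symm
  rw [selfCommutator, sub_apply, mul_apply_eq_comp, mul_apply_eq_comp, inner_sub_left, h1, h2,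
    inner_self_eq_norm_sq_to_K, inner_self_eq_norm_sq_to_K]
  simp [← Complex.ofReal_pow]

theorem isSelfAdjoint_selfCommutator (T : H →L[ℂ] H) : IsSelfAdjoint (selfCommutator T) :=
  (IsSelfAdjoint.star_mul_self T).sub (IsSelfAdjoint.mul_star_self T)

theorem isHyponormal_iff_norm_star_apply_le {T : H →L[ℂ] H} :
    IsHyponormal T ↔ ∀ x, ‖star T x‖ ≤ ‖T x‖ := by
  rw [IsHyponormal, ContinuousLinearMap.isPositive_def',
    and_iff_right (isSelfAdjoint_selfCommutator T)]
  refine forall_congr' fun x => ?_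
  rw [ContinuousLinearMap.reApplyInnerSelf_apply, RCLike.re_to_complex,
    re_inner_selfCommutator_apply, sub_nonneg, sq_le_sq₀ (norm_nonneg _) (norm_nonneg _)]

theorem selfCommutator_sub_algebraMap (T : H →L[ℂ] H) (z : ℂ) :
    selfCommutator (T - algebraMap ℂ (H →L[ℂ] H) z) = selfCommutator T := by
  rw [selfCommutator, selfCommutator, star_sub, ← algebraMap_star_comm, mul_sub, sub_mul, sub_mul,
    sub_mul, mul_sub, mul_sub, Algebra.commutes z (star T), Algebra.commutes (star z) T,
    Algebra.commutes z (algebraMap ℂ (H →L[ℂ] H) (star z))]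
  abel

/-- Orthogonally to every finite dimensional subspace there are unit vectors that `A` and `A*` both
map close to zero. For `A = T - z` these are approximate eigenvectors of `T` for `z` and of `T*`
for the conjugate of `z` at once. -/
def HasApproxReducingVectors (A : H →L[ℂ] H) : Prop :=
  ∀ (F : Submodule ℂ H) [FiniteDimensional ℂ F] (ε : ℝ), 0 < ε →
    ∃ x ∈ Fᗮ, ‖x‖ = 1 ∧ ‖A x‖ ≤ ε ∧ ‖star A x‖ ≤ ε

/-- If `A` has no left inverse modulo the compact operators and `M` is, modulo the compact
operators, a left multiple of `A`, then `M` is not coercive on any subspace of finite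
codimension. -/
theorem exists_unit_vector_of_not_leftInverse {A : H →L[ℂ] H}
    (hA : ∀ S : H →L[ℂ] H, ¬ IsCompactOperator (S * A - 1 : H →L[ℂ] H)) {M : H →L[ℂ] H}
    (hM : IsSelfAdjoint M)
    (hMA : ∃ S : H →L[ℂ] H, IsCompactOperator (M - S * A : H →L[ℂ] H))
    (F : Submodule ℂ H) [FiniteDimensional ℂ F] {ε : ℝ} (hε : 0 < ε) :
    ∃ x ∈ Fᗮ, ‖x‖ = 1 ∧ (inner ℂ (M x) x).re ≤ ε := by
  by_contra! hcon
  obtain ⟨S, hS⟩ := exists_leftInverse_mod_compact hM F hε fun x hx => by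
    rcases eq_or_ne x 0 with rfl | hx0
    · simp
    have hn : 0 < ‖x‖ := norm_pos_iff.2 hx0
    have h1 := (hcon (((‖x‖⁻¹ : ℝ) : ℂ) • x) (Fᗮ.smul_mem _ hx) (by
      rw [norm_smul]; simp [hn.ne'])).le
    rw [map_smul, inner_smul_left, inner_smul_right, Complex.conj_ofReal, Complex.re_ofReal_mul,
      Complex.re_ofReal_mul] at h1
    calc ε * ‖x‖ ^ 2 ≤ (‖x‖⁻¹ * (‖x‖⁻¹ * (inner ℂ (M x) x).re)) * ‖x‖ ^ 2 := by gcongr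
      _ = _ := by field_simp
  obtain ⟨R, hR⟩ := hMA
  refine hA (S * R) ?_
  have h := (compactIdeal H).sub_mem (mem_compactIdeal.2 hS)
    ((compactIdeal H).mul_mem_left S (mem_compactIdeal.2 hR))
  rw [show S * M - 1 - S * (M - R * A) = S * R * A - 1 by noncomm_ring] at h
  exact h

/-- For an essentially normal or hyponormal `T`, some `T - z` has approximately reducing vectors.
In both cases `z` is such that `A = T - z` is not left invertible modulo the compact operators. -/
theorem exists_hasApproxReducingVectors (hH : ¬ FiniteDimensional ℂ H) {T : H →L[ℂ] H}
    (hT : IsEssentiallyNormal T ∨ IsHyponormal T) :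
    ∃ z : ℂ, HasApproxReducingVectors (T - algebraMap ℂ (H →L[ℂ] H) z) := by
  obtain ⟨z, hz⟩ := exists_forall_not_leftInverse_mod_compact hH T
  refine ⟨z, fun F _ ε hε => ?_⟩
  set A := T - algebraMap ℂ (H →L[ℂ] H) z with hAdef
  have hAA : selfCommutator A = selfCommutator T := selfCommutator_sub_algebraMap T z
  have hsq : ∀ {a : ℝ}, a ^ 2 ≤ ε ^ 2 → a ≤ ε := fun h =>
    le_of_sq_le_sq h hε.le
  have hre : ∀ x, (inner ℂ ((star A * A) x) x).re = ‖A x‖ ^ 2 := fun x => by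
    have h1 : inner ℂ ((star A) (A x)) x = inner ℂ (A x) (A x) :=
      ContinuousLinearMap.adjoint_inner_left A x (A x)
    rw [mul_apply_eq_comp, h1, inner_self_eq_norm_sq_to_K]
    simp [← Complex.ofReal_pow]
  rcases hT with hT | hT
  -- This `M` is `A* A + A A*`, so that `⟨M x, x⟩ = ‖A x‖² + ‖A* x‖²`; modulo the compact operators
  -- it is `2 A* A`.
  · obtain ⟨x, hxF, hx, h⟩ := exists_unit_vector_of_not_leftInverse hz
      (M := star A * A + star A * A - selfCommutator A)
      (((IsSelfAdjoint.star_mul_self A).add (IsSelfAdjoint.star_mul_self A)).sub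
        (isSelfAdjoint_selfCommutator A))
      ⟨star A + star A, by
        rw [hAA, add_mul, sub_sub_cancel_left]
        exact IsCompactOperator.neg hT⟩ F (pow_pos hε 2)
    rw [sub_apply, add_apply, inner_sub_left, inner_add_left, Complex.sub_re, Complex.add_re,
      hre, re_inner_selfCommutator_apply] at h
    exact ⟨x, hxF, hx, hsq (by linarith [sq_nonneg ‖star A x‖]),
      hsq (by linarith [sq_nonneg ‖A x‖])⟩
  -- Here `A* A` suffices, since `‖A* x‖ ≤ ‖A x‖`.
  · obtain ⟨x, hxF, hx, h⟩ := exists_unit_vector_of_not_leftInverse hz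
      (IsSelfAdjoint.star_mul_self A) ⟨star A, by
        rw [sub_self]; exact isCompactOperator_zero⟩ F (pow_pos hε 2)
    rw [hre] at h
    have hA : IsHyponormal A := by rwa [IsHyponormal, hAA]
    exact ⟨x, hxF, hx, hsq h, (isHyponormal_iff_norm_star_apply_le.1 hA x).trans (hsq h)⟩

/-- Approximately reducing vectors span subspaces of any dimension on which `A` and `A*` are
uniformly small. In the induction both the previous subspace and the new vector are taken for
`ε / 2`, which leaves room for the triangle inequality. -/
theorem HasApproxReducingVectors.exists_submodule {A : H →L[ℂ] H}
    (hA : HasApproxReducingVectors A) (F : Submodule ℂ H) [FiniteDimensional ℂ F] (m : ℕ) :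
    ∀ ε : ℝ, 0 < ε → ∃ V : Submodule ℂ H, FiniteDimensional ℂ V ∧ Module.finrank ℂ V = m ∧
      V ≤ Fᗮ ∧ ∀ v ∈ V, ‖A v‖ ≤ ε * ‖v‖ ∧ ‖star A v‖ ≤ ε * ‖v‖ := by
  induction m with
  | zero => exact fun ε hε => ⟨⊥, inferInstance, by simp, bot_le, by simp⟩
  | succ m ih =>
    intro ε hε
    obtain ⟨V, hVfin, hVm, hVF, hV⟩ := ih (ε / 2) (half_pos hε)
    obtain ⟨x, hx, hx1, hxA, hxA'⟩ := hA (F ⊔ V) (ε / 2) (half_pos hε)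
    rw [← Submodule.inf_orthogonal] at hx
    have hx0 : x ≠ 0 := by rintro rfl; simp at hx1
    refine ⟨V ⊔ ℂ ∙ x, inferInstance, ?_, sup_le hVF ?_, ?_⟩
    · have hdis : V ⊓ ℂ ∙ x = ⊥ := by
        rw [← disjoint_iff]
        refine (Submodule.isOrtho_iff_le.2 ?_).disjoint
        intro v hv
        rw [Submodule.mem_orthogonal_singleton_iff_inner_left]
        exact hx.2 v hv
      have := Submodule.finrank_sup_add_finrank_inf_eq V (ℂ ∙ x)
      rw [hdis, finrank_bot, hVm, finrank_span_singleton hx0] at this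
      simpa using this
    · rw [Submodule.span_singleton_le_iff_mem]
      exact hx.1
    · intro w hw
      obtain ⟨v, hv, y, hy, rfl⟩ := Submodule.mem_sup.1 hw
      obtain ⟨c, rfl⟩ := Submodule.mem_span_singleton.1 hy
      have hvx : inner ℂ v (c • x) = 0 := by rw [inner_smul_right, hx.2 v hv, mul_zero]
      have hpy := norm_add_sq_eq_norm_sq_add_norm_sq_of_inner_eq_zero v (c • x) hvx
      have hv1 : ‖v‖ ≤ ‖v + c • x‖ :=
        le_of_sq_le_sq (by nlinarith [mul_self_nonneg ‖c • x‖]) (norm_nonneg _)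
      have hc1 : ‖c‖ ≤ ‖v + c • x‖ := by
        have : ‖c • x‖ = ‖c‖ := by rw [norm_smul, hx1, mul_one]
        rw [← this]
        exact le_of_sq_le_sq (by nlinarith [mul_self_nonneg ‖v‖]) (norm_nonneg _)
      have key : ∀ B : H →L[ℂ] H, ‖B v‖ ≤ ε / 2 * ‖v‖ → ‖B x‖ ≤ ε / 2 →
          ‖B (v + c • x)‖ ≤ ε * ‖v + c • x‖ := fun B h1 h2 =>
        calc ‖B (v + c • x)‖ ≤ ‖B v‖ + ‖c‖ * ‖B x‖ := by
              rw [map_add, map_smul, ← norm_smul]; exact norm_add_le _ _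
          _ ≤ ε / 2 * ‖v + c • x‖ + ‖v + c • x‖ * (ε / 2) := by
              gcongr
              exact h1.trans (by gcongr)
          _ = _ := by ring
      exact ⟨key A (hV v hv).1 hxA, key _ (hV v hv).2 hxA'⟩

end ApproxReducing

/-! ### Hilbert–Schmidt estimates -/

section HilbertSchmidt

variable {H : Type*} [NormedAddCommGroup H] [InnerProductSpace ℂ H] [CompleteSpace H]

theorem hsNorm_sq {ι : Type*} (b : HilbertBasis ι ℂ H) (T : H →L[ℂ] H) :
    hsNorm T ^ 2 = hsNormSqBasis b T := by
  rw [hsNorm_eq b, ← ENNReal.rpow_natCast, ← ENNReal.rpow_mul]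
  norm_num [hsNormSqBasis]

theorem hsNorm_star (T : H →L[ℂ] H) : hsNorm (star T) = hsNorm T := by
  obtain ⟨w, b, -⟩ := exists_hilbertBasis ℂ H
  rw [hsNorm_eq b, hsNorm_eq b]
  exact congrArg (· ^ (1 / 2 : ℝ)) (hsNormSqBasis_adjoint b b T).symm

theorem hsNorm_mul_sq_le {A P : H →L[ℂ] H} {c : ℝ} (hc : 0 ≤ c)
    (h : ∀ x, ‖A (P x)‖ ≤ c * ‖P x‖) :
    hsNorm (A * P) ^ 2 ≤ ENNReal.ofReal (c ^ 2) * hsNorm P ^ 2 := by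
  obtain ⟨w, b, -⟩ := exists_hilbertBasis ℂ H
  rw [hsNorm_sq b, hsNorm_sq b, hsNormSqBasis, hsNormSqBasis, ← ENNReal.tsum_mul_left]
  refine ENNReal.tsum_le_tsum fun i => ?_
  rw [ENNReal.ofReal_pow hc, ← mul_pow]
  gcongr
  rw [← ofReal_norm, ← ofReal_norm, ← ENNReal.ofReal_mul hc]
  exact ENNReal.ofReal_le_ofReal (h _)

theorem hsNorm_mul_sq_le_of_star {A P : H →L[ℂ] H} (hP : IsSelfAdjoint P) {c : ℝ} (hc : 0 ≤ c)
    (h : ∀ x, ‖star A (P x)‖ ≤ c * ‖P x‖) :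
    hsNorm (P * A) ^ 2 ≤ ENNReal.ofReal (c ^ 2) * hsNorm P ^ 2 := by
  rw [← hsNorm_star, star_mul, hP.star_eq]
  exact hsNorm_mul_sq_le hc h

theorem hsNorm_add_sq_le (S T : H →L[ℂ] H) :
    hsNorm (S + T) ^ 2 ≤ 2 * (hsNorm S ^ 2 + hsNorm T ^ 2) := by
  obtain ⟨w, b, -⟩ := exists_hilbertBasis ℂ H
  rw [hsNorm_sq b, hsNorm_sq b, hsNorm_sq b, hsNormSqBasis, hsNormSqBasis, hsNormSqBasis,
    ← ENNReal.tsum_add, ← ENNReal.tsum_mul_left]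
  refine ENNReal.tsum_le_tsum fun i => ?_
  have h : ‖(S + T) (b i)‖ ^ 2 ≤ 2 * (‖S (b i)‖ ^ 2 + ‖T (b i)‖ ^ 2) := by
    have := norm_add_le (S (b i)) (T (b i))
    rw [add_apply]
    nlinarith [sq_nonneg (‖S (b i)‖ - ‖T (b i)‖), norm_nonneg (S (b i) + T (b i))]
  have h' := ENNReal.ofReal_le_ofReal h
  rw [ENNReal.ofReal_mul zero_le_two, ENNReal.ofReal_add (sq_nonneg _) (sq_nonneg _)] at h'
  simpa [ENNReal.ofReal_pow, ofReal_norm] using h'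

theorem hsNorm_neg (T : H →L[ℂ] H) : hsNorm (-T) = hsNorm T := by
  obtain ⟨w, b, -⟩ := exists_hilbertBasis ℂ H
  simp [hsNorm_eq b]

theorem hsNorm_starProjection_sq (V : Submodule ℂ H) [FiniteDimensional ℂ V] :
    hsNorm V.starProjection ^ 2 = Module.finrank ℂ V := by
  obtain ⟨w, b, -⟩ := exists_hilbertBasis ℂ H
  set e := stdOrthonormalBasis ℂ V
  have h : ∀ y, ‖V.starProjection y‖ₑ ^ 2 = ∑ j, ‖inner ℂ y (e j : H)‖ₑ ^ 2 := fun y => by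
    have h1 := e.sum_sq_norm_inner_left (V.orthogonalProjectionOnto y)
    simp only [Submodule.inner_orthogonalProjectionOnto_eq_of_mem_right] at h1
    have h2 := congrArg ENNReal.ofReal h1
    rw [ENNReal.ofReal_sum_of_nonneg fun _ _ => sq_nonneg _] at h2
    simp only [ENNReal.ofReal_pow (norm_nonneg _), ofReal_norm] at h2
    exact h2.symm
  rw [hsNorm_sq b, hsNormSqBasis]
  simp_rw [h]
  rw [Summable.tsum_finsetSum fun _ _ => ENNReal.summable]
  simp_rw [tsum_enorm_inner_sq]
  have he : ∀ j, ‖(e j : H)‖ₑ = 1 := fun j => by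
    rw [← ofReal_norm, Submodule.norm_coe, e.orthonormal.1 j, ENNReal.ofReal_one]
  simp [he]

end HilbertSchmidt

/-! ### Almost commuting projections and Følner sequences -/

section Folner

variable {H : Type*} [NormedAddCommGroup H] [InnerProductSpace ℂ H]

theorem starProjection_sup_of_le_orthogonal {F V : Submodule ℂ H} [FiniteDimensional ℂ F]
    [FiniteDimensional ℂ V] (h : V ≤ Fᗮ) :
    (F ⊔ V).starProjection = F.starProjection + V.starProjection := by
  ext x
  rw [add_apply]
  refine Submodule.eq_starProjection_of_mem_orthogonal (Submodule.add_mem_sup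
    (F.starProjection_apply_mem x) (V.starProjection_apply_mem x)) ?_
  have hF : F ≤ Vᗮ := Submodule.le_orthogonal_iff_le_orthogonal.1 h
  rw [← Submodule.inf_orthogonal]
  constructor
  · rw [← sub_sub]
    exact Fᗮ.sub_mem (F.sub_starProjection_mem_orthogonal x)
      (h (Submodule.starProjection_apply_mem _ _))
  · rw [add_comm, ← sub_sub]
    exact Vᗮ.sub_mem (V.sub_starProjection_mem_orthogonal x)
      (hF (Submodule.starProjection_apply_mem _ _))

theorem tendsto_starProjection_of_dense {W : ℕ → Submodule ℂ H}
    [∀ n, FiniteDimensional ℂ (W n)] (hW : Monotone W) {d : ℕ → H} (hd : DenseRange d)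
    (hdW : ∀ n, d n ∈ W (n + 1)) (x : H) :
    Tendsto (fun n => (W n).starProjection x) atTop (𝓝 x) := by
  refine Submodule.starProjection_tendsto_self W hW x ?_
  rw [top_le_iff, ← Submodule.dense_iff_topologicalClosure_eq_top]
  refine hd.mono ?_
  rintro _ ⟨n, rfl⟩
  exact le_iSup W (n + 1) (hdW n)

variable [CompleteSpace H]

/-- Every finite dimensional `F` lies in a finite dimensional `W` whose projection almost commutes
with `T` in the normalized Hilbert–Schmidt norm. -/
theorem exists_almostCommuting_superspace [Nontrivial H] {T : H →L[ℂ] H}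
    (hT : IsEssentiallyNormal T ∨ IsHyponormal T) (F : Submodule ℂ H) [FiniteDimensional ℂ F]
    {ε : ℝ} (hε : 0 < ε) :
    ∃ W : Submodule ℂ H, FiniteDimensional ℂ W ∧ F ≤ W ∧ W ≠ ⊥ ∧
      ∀ [FiniteDimensional ℂ W], hsNorm (T * W.starProjection - W.starProjection * T) ≤
        ENNReal.ofReal ε * hsNorm W.starProjection := by
  by_cases hH : FiniteDimensional ℂ H
  · refine ⟨⊤, inferInstance, le_top, top_ne_bot, ?_⟩
    intro _
    obtain ⟨w, b, -⟩ := exists_hilbertBasis ℂ H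
    rw [Submodule.starProjection_top', mul_one, one_mul, sub_self, hsNorm_eq b]
    simp
  obtain ⟨z, hA⟩ := exists_hasApproxReducingVectors hH hT
  set A := T - algebraMap ℂ (H →L[ℂ] H) z with hAdef
  set δ := ε / 4 with hδ
  have hδ0 : 0 < δ := by positivity
  -- `W = F ⊔ V` with `V ⟂ F` of dimension `m` almost reducing for `A = T - z`: the commutator with
  -- `P_F` has squared norm at most a constant times `‖T‖² dim F`, independent of `m`, and this
  -- choice of `m` makes it small against `m ≤ ‖P_W‖₂²`.
  obtain ⟨m, hm⟩ := exists_nat_ge (‖T‖ ^ 2 * Module.finrank ℂ F / δ ^ 2 + 1)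
  have hm1 : 1 ≤ m := by
    have h0 : 0 ≤ ‖T‖ ^ 2 * Module.finrank ℂ F / δ ^ 2 := by positivity
    have : (1 : ℝ) ≤ m := by linarith
    exact_mod_cast this
  have hm2 : ‖T‖ ^ 2 * Module.finrank ℂ F ≤ δ ^ 2 * m := by
    rw [← div_le_iff₀' (by positivity)]
    linarith
  obtain ⟨V, hVfin, hVm, hVF, hV⟩ := hA.exists_submodule F m δ hδ0
  have hV0 : V ≠ ⊥ := by
    rintro rfl
    rw [finrank_bot] at hVm
    omega
  refine ⟨F ⊔ V, inferInstance, le_sup_left, fun h => hV0 (sup_eq_bot_iff.1 h).2, ?_⟩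
  intro _
  have hfr : Module.finrank ℂ (F ⊔ V : Submodule ℂ H) = Module.finrank ℂ F + m := by
    have h := Submodule.finrank_sup_add_finrank_inf_eq F V
    have hdis : F ⊓ V = ⊥ := (Submodule.isOrtho_iff_le.2
      (Submodule.le_orthogonal_iff_le_orthogonal.1 hVF)).disjoint.eq_bot
    rwa [hdis, finrank_bot, add_zero, hVm] at h
  rw [← ENNReal.pow_le_pow_left_iff two_ne_zero, mul_pow, hsNorm_starProjection_sq, hfr]
  set P := F.starProjection with hP
  set Q := V.starProjection with hQ
  have hcomm : T * (F ⊔ V).starProjection - (F ⊔ V).starProjection * T =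
      (T * P + -(P * T)) + (A * Q + -(Q * A)) := by
    have h := Algebra.commutes z Q
    rw [starProjection_sup_of_le_orthogonal hVF, hAdef, sub_mul, mul_sub Q, ← h, mul_add, add_mul]
    abel
  have hPsa : IsSelfAdjoint P := isSelfAdjoint_starProjection F
  have hQsa : IsSelfAdjoint Q := isSelfAdjoint_starProjection V
  have h1 := hsNorm_mul_sq_le (norm_nonneg T) fun x => T.le_opNorm (P x)
  have h2 := hsNorm_mul_sq_le_of_star (A := T) hPsa (norm_nonneg T) fun x => by
    rw [← norm_star T]
    exact (star T).le_opNorm (P x)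
  have h3 := hsNorm_mul_sq_le hδ0.le fun x => (hV (Q x) (Submodule.starProjection_apply_mem _ _)).1
  have h4 := hsNorm_mul_sq_le_of_star hQsa hδ0.le fun x =>
    (hV (Q x) (Submodule.starProjection_apply_mem _ _)).2
  rw [hsNorm_starProjection_sq, ← ENNReal.ofReal_natCast,
    ← ENNReal.ofReal_mul (sq_nonneg _)] at h1 h2 h3 h4
  rw [hVm] at h3 h4
  have hm3 := ENNReal.ofReal_le_ofReal hm2
  calc hsNorm (T * (F ⊔ V).starProjection - (F ⊔ V).starProjection * T) ^ 2
      ≤ 2 * (2 * (hsNorm (T * P) ^ 2 + hsNorm (P * T) ^ 2) +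
          2 * (hsNorm (A * Q) ^ 2 + hsNorm (Q * A) ^ 2)) := by
        rw [hcomm]
        refine (hsNorm_add_sq_le _ _).trans ?_
        gcongr
        · exact (hsNorm_add_sq_le _ _).trans_eq (by rw [hsNorm_neg])
        · exact (hsNorm_add_sq_le _ _).trans_eq (by rw [hsNorm_neg])
    _ ≤ 2 * (2 * (ENNReal.ofReal (δ ^ 2 * m) + ENNReal.ofReal (δ ^ 2 * m)) +
          2 * (ENNReal.ofReal (δ ^ 2 * m) + ENNReal.ofReal (δ ^ 2 * m))) := by
        gcongr
        · exact h1.trans hm3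
        · exact h2.trans hm3
    _ = ENNReal.ofReal (ε ^ 2 * m) := by
        rw [show ε ^ 2 * m = 16 * (δ ^ 2 * m) by rw [hδ]; ring,
          ENNReal.ofReal_mul (p := 16) (by norm_num)]
        norm_num
        ring
    _ ≤ _ := by
        rw [ENNReal.ofReal_mul (sq_nonneg _), ENNReal.ofReal_pow hε.le, ENNReal.ofReal_natCast]
        gcongr
        simp

theorem hasProperFolnerSeq_of_exists_superspace [TopologicalSpace.SeparableSpace H]
    {T : H →L[ℂ] H}
    (h : ∀ (F : Submodule ℂ H) [FiniteDimensional ℂ F] (ε : ℝ), 0 < ε →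
      ∃ W : Submodule ℂ H, FiniteDimensional ℂ W ∧ F ≤ W ∧ W ≠ ⊥ ∧
      ∀ [FiniteDimensional ℂ W], hsNorm (T * W.starProjection - W.starProjection * T) ≤
        ENNReal.ofReal ε * hsNorm W.starProjection) :
    HasProperFolnerSeq T := by
  let d := TopologicalSpace.denseSeq H
  choose! G hGfin hGle hGne hG using
    fun (F : {F : Submodule ℂ H // FiniteDimensional ℂ F}) (n : ℕ) =>
      haveI := F.2
      h F.1 (1 / ((n : ℝ) + 1)) Nat.one_div_pos_of_nat
  -- `W (n + 1)` contains `W n` and the `n`-th vector of a dense sequence.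
  let W : ℕ → {F : Submodule ℂ H // FiniteDimensional ℂ F} := fun n =>
    Nat.rec ⟨G ⟨⊥, inferInstance⟩ 0, hGfin _ _⟩ (fun k F =>
      ⟨G ⟨F.1 ⊔ ℂ ∙ d k, haveI := F.2; inferInstance⟩ (k + 1), hGfin _ _⟩) n
  have hfin : ∀ n, FiniteDimensional ℂ (W n).1 := fun n => (W n).2
  have hsucc : ∀ n, (W n).1 ⊔ ℂ ∙ d n ≤ (W (n + 1)).1 := fun n =>
    hGle ⟨(W n).1 ⊔ ℂ ∙ d n, haveI := hfin n; inferInstance⟩ (n + 1)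
  have hmono : Monotone fun n => (W n).1 :=
    monotone_nat_of_le_succ fun n => le_sup_left.trans (hsucc n)
  have hne : ∀ n, (W n).1 ≠ ⊥ := fun n => by cases n <;> exact hGne _ _
  have hWc : ∀ n : ℕ, hsNorm (T * (W n).1.starProjection - (W n).1.starProjection * T) ≤
      ENNReal.ofReal (1 / ((n : ℝ) + 1)) * hsNorm (W n).1.starProjection := fun n => by
    cases n <;> exact hG _ _
  refine ⟨fun n => (W n).1.starProjection, ⟨⟨fun n => isStarProjection_starProjection,
    fun n h0 => hne n ?_, fun n => ?_, ?_⟩, fun m n hmn => ?_, ?_⟩⟩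
  · rw [← Submodule.range_starProjection (W n).1]
    simp [h0]
  · rw [Submodule.range_starProjection]
    exact hfin n
  · rintro _ rfl
    have hlim : Tendsto (fun n : ℕ => ENNReal.ofReal (1 / ((n : ℝ) + 1))) atTop (𝓝 0) := by
      simpa using ENNReal.tendsto_ofReal tendsto_one_div_add_atTop_nhds_zero_nat
    exact tendsto_of_tendsto_of_tendsto_of_le_of_le tendsto_const_nhds hlim
      (fun _ => zero_le) fun n => ENNReal.div_le_of_le_mul (hWc n)
  · exact Submodule.starProjection_le_starProjection_iff.2 (hmono hmn)
  · exact tendsto_starProjection_of_dense hmono (TopologicalSpace.denseRange_denseSeq H)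
      fun n => hsucc n (le_sup_right (a := (W n).1) (Submodule.mem_span_singleton_self _))

theorem hasProperFolnerSeq_of_essentiallyNormal_or_hyponormal [TopologicalSpace.SeparableSpace H]
    [Nontrivial H] {T : H →L[ℂ] H} (hT : IsEssentiallyNormal T ∨ IsHyponormal T) :
    HasProperFolnerSeq T :=
  hasProperFolnerSeq_of_exists_superspace fun F _ _ hε =>
    exists_almostCommuting_superspace hT F hε

end Folner

/-! ### Classes of hyponormal operators -/

/-- If `T` is the restriction of a normal `N`, then `T*` is the compression of `N*`, so that
`‖T* x‖ ≤ ‖N* x‖ = ‖N x‖ = ‖T x‖`. -/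
theorem IsSubnormal.isHyponormal {H : Type u} [NormedAddCommGroup H] [InnerProductSpace ℂ H]
    [CompleteSpace H] {T : H →L[ℂ] H} (hT : IsSubnormal.{u, v} T) : IsHyponormal T := by
  obtain ⟨K, _, _, _, V, N, hN, hNV⟩ := hT
  refine isHyponormal_iff_norm_star_apply_le.2 fun x => ?_
  have h1 : ‖star N (V x)‖ = ‖N (V x)‖ := by
    have h := re_inner_selfCommutator_apply N (V x)
    have h0 : selfCommutator N = 0 := sub_eq_zero.2 hN.star_comm_self
    rw [h0, zero_apply, inner_zero_left, Complex.zero_re] at h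
    exact ((sq_eq_sq₀ (norm_nonneg _) (norm_nonneg _)).1 (sub_eq_zero.1 h.symm)).symm
  have h2 : star T x = V.toContinuousLinearMap.adjoint (star N (V x)) := by
    refine ext_inner_right ℂ fun y => ?_
    have ha : inner ℂ (star T x) y = inner ℂ x (T y) :=
      ContinuousLinearMap.adjoint_inner_left T y x
    have hb : inner ℂ (star N (V x)) (V y) = inner ℂ (V x) (N (V y)) :=
      ContinuousLinearMap.adjoint_inner_left N (V y) (V x)
    rw [ContinuousLinearMap.adjoint_inner_left, ha, LinearIsometry.coe_toContinuousLinearMap, hb,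
      hNV, V.inner_map_map]
  calc ‖star T x‖ ≤ ‖V.toContinuousLinearMap.adjoint‖ * ‖star N (V x)‖ := by
        rw [h2]; exact ContinuousLinearMap.le_opNorm _ _
    _ ≤ 1 * ‖star N (V x)‖ := by
        gcongr
        rw [LinearIsometryEquiv.norm_map]
        exact V.norm_toContinuousLinearMap_le
    _ = ‖T x‖ := by rw [one_mul, h1, hNV, V.norm_map]

/-- If `T` is quasinormal, then `[T*, T]` vanishes on the range of `T`, hence is supported on
`ker T*`, where it is `T* T`. -/
theorem IsQuasinormal.isHyponormal {H : Type*} [NormedAddCommGroup H]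
    [InnerProductSpace ℂ H] [CompleteSpace H] {T : H →L[ℂ] H} (hT : IsQuasinormal T) :
    IsHyponormal T := by
  set D := selfCommutator T with hD
  have hDsa : IsSelfAdjoint D := isSelfAdjoint_selfCommutator T
  have hDT : D * T = 0 := by
    have h : T * (star T * T) = star T * T * T := hT
    rw [hD, selfCommutator, sub_mul, mul_assoc T, h, sub_self]
  have hTD : star T * D = 0 := by
    rw [← star_eq_zero, star_mul, star_star, hDsa.star_eq, hDT]
  set K := (star T).ker
  have : CompleteSpace K := (star T).isClosed_ker.completeSpace_coe
  refine ContinuousLinearMap.isPositive_def'.2 ⟨hDsa, fun x => ?_⟩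
  rw [ContinuousLinearMap.reApplyInnerSelf_apply, RCLike.re_to_complex]
  set y := K.starProjection x
  have hsymm : ∀ u v, inner ℂ (D u) v = inner ℂ u (D v) := hDsa.isSymmetric
  have hDK : ∀ v, D v ∈ K := fun v => congrArg (fun B : H →L[ℂ] H => B v) hTD
  have hDy : D x = D y := by
    rw [← sub_eq_zero, ← map_sub]
    refine ext_inner_right ℂ fun v => ?_
    rw [hsymm, inner_zero_left]
    exact Submodule.inner_left_of_mem_orthogonal (hDK v) (K.sub_starProjection_mem_orthogonal x)
  have hy : star T y = 0 := K.starProjection_apply_mem x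
  rw [hDy, hsymm, hDy, ← hsymm, re_inner_selfCommutator_apply, hy]
  simp

theorem isHyponormal_of_isometry {H : Type*} [NormedAddCommGroup H]
    [InnerProductSpace ℂ H] [CompleteSpace H] {T : H →L[ℂ] H} (hT : Isometry T) :
    IsHyponormal T := by
  refine isHyponormal_iff_norm_star_apply_le.2 fun x => ?_
  have hn : ∀ y, ‖T y‖ = ‖y‖ := (AddMonoidHomClass.isometry_iff_norm T).1 hT
  calc ‖star T x‖ ≤ ‖star T‖ * ‖x‖ := (star T).le_opNorm x
    _ ≤ 1 * ‖x‖ := by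
      gcongr
      rw [norm_star]
      exact T.opNorm_le_bound zero_le_one fun y => by rw [hn, one_mul]
    _ = ‖T x‖ := by rw [one_mul, hn]

end FolnerOp

theorem corollary5p2 {H : Type u} [NormedAddCommGroup H] [InnerProductSpace ℂ H]
    [CompleteSpace H] [TopologicalSpace.SeparableSpace H] [Nontrivial H] (T : H →L[ℂ] H) :
    (FolnerOp.IsEssentiallyNormal T → FolnerOp.HasProperFolnerSeq T) ∧
    (FolnerOp.IsHyponormal T → FolnerOp.HasProperFolnerSeq T) ∧
    (FolnerOp.IsSubnormal.{u, v} T → FolnerOp.HasProperFolnerSeq T) ∧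
    (FolnerOp.IsQuasinormal T → FolnerOp.HasProperFolnerSeq T) ∧
    (Isometry T → FolnerOp.HasProperFolnerSeq T) := by
  refine ⟨fun h => ?_, fun h => ?_, fun h => ?_, fun h => ?_, fun h => ?_⟩ <;>
    apply FolnerOp.hasProperFolnerSeq_of_essentiallyNormal_or_hyponormal
  exacts [.inl h, .inr h, .inr h.isHyponormal, .inr h.isHyponormal,
    .inr (FolnerOp.isHyponormal_of_isometry h)]
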